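/- Theorem. Let $k\ge 1$ be a fixed integer. There is an exponent $d$ (depending only on $k$) such that for all constants $b,c\in\mathbb{N}$ there are a constant $C$ and a randomized algorithm in the LOCAL model with the following property. Let $G$ be any connected undirected graph with $n$ vertices carrying distinct natural numbers as identifiers, let $\varepsilon>0$, and let $N$ be an integer with $n\le N\le n^{b}$. Suppose that every vertex initially knows $N$, $\varepsilon$, its own identifier and the identifiers of its neighbours, and has its own private independent random bits. Then on the network $G$ the algorithm always stops after at most $$C\left(\frac{\log n}{\min(\varepsilon,1)}\right)^{d}=\mathrm{poly}(\log n/\min(\varepsilon,1))$$ synchronous communication rounds, each vertex outputs a subset of its incident edges, and with probability at least $1-1/n^{c}$ the union $H$ of all the outputs is a $(1+\varepsilon)$-approximation of the minimum $k$-spanner of $G$. That is, for every edge $\{u,v\}$ of $G$ the set $H$ contains a path of length at most $k$ between $u$ and $v$ (so $H$ is a $k$-spanner), and $|H|\le(1+\varepsilon)\,|H'|$ for every $k$-spanner $H'\subseteq E(G)$ of $G$. Here, in the LOCAL model, in every round each vertex sends a message of unbounded size to each of its neighbours, and local computation is unrestricted. -/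

import Mathlib

/-- `S` covers the pair `u, v` with stretch `k`: the graph with edge set `S` contains a path of
length at most `k` between `u` and `v`. -/
def EdgeCovered {V : Type*} (S : Set (Sym2 V)) (k : ℕ) (u v : V) : Prop :=
  ∃ p : (SimpleGraph.fromEdgeSet S).Walk u v, p.IsPath ∧ p.length ≤ k

/-- `S` is (the edge set of) a `k`-spanner of `G`: a set of edges of `G` that covers every edge
of `G`. -/
def IsKSpanner {V : Type*} (G : SimpleGraph V) (k : ℕ) (S : Set (Sym2 V)) : Prop :=
  S ⊆ G.edgeSet ∧ ∀ u v : V, G.Adj u v → EdgeCovered S k u v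

/-- `S` is a `(1 + ε)`-approximation of the minimum `k`-spanner of `G`: it is a `k`-spanner with
at most `1 + ε` times as many edges as any `k`-spanner of `G` (in particular, a minimum one). -/
def IsApproxMinSpanner {V : Type*} (G : SimpleGraph V) (k : ℕ) (ε : ℝ) (S : Set (Sym2 V)) : Prop :=
  IsKSpanner G k S ∧
    ∀ T : Set (Sym2 V), IsKSpanner G k T → (S.ncard : ℝ) ≤ (1 + ε) * (T.ncard : ℝ)

/-- A randomized algorithm in the LOCAL model, whose output at each vertex is a set of incident
edges. All vertices run the same code. Messages have unbounded size and local computation is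
unrestricted; identifiers are natural numbers. -/
structure LocalAlgorithm where
  /-- the local states of a vertex -/
  State : Type
  /-- the messages -/
  Msg : Type
  /-- the number of private random bits of each vertex -/
  coins : ℕ
  /-- the number of synchronous communication rounds after which every vertex stops -/
  rounds : ℕ
  /-- the initial state, from the vertex's own identifier, the set of identifiers of its
  neighbours, and its private random bits -/
  init : ℕ → Set ℕ → (Fin coins → Bool) → State
  /-- the message that a vertex in a given state sends to the neighbour with a given identifier -/
  send : State → ℕ → Msg
  /-- the state after a round, from the state before it and the set of received messages, each
  paired with the identifier of its sender -/
  step : State → Set (ℕ × Msg) → State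
  /-- the output: the identifiers of those neighbours the edges to which are chosen -/
  output : State → Set ℕ

namespace LocalAlgorithm

/-- An outcome of all the private random bits in a network with vertex set `V`. -/
abbrev Coins (A : LocalAlgorithm) (V : Type*) : Type _ := V → Fin A.coins → Bool

/-- The state of every vertex after `t` rounds of the execution of `A` on the network `G`, with
identifiers `ident` and random bits `ω`. -/
def stateAt (A : LocalAlgorithm) {V : Type*} (G : SimpleGraph V) (ident : V → ℕ)
    (ω : A.Coins V) : ℕ → V → A.State
  | 0, v => A.init (ident v) (ident '' G.neighborSet v) (ω v)
  | t + 1, v =>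
      A.step (stateAt A G ident ω t v)
        {m | ∃ u, G.Adj v u ∧ m = (ident u, A.send (stateAt A G ident ω t u) (ident v))}

/-- The union, over all vertices, of the sets of incident edges output at the end of the
execution. -/
def outputEdges (A : LocalAlgorithm) {V : Type*} (G : SimpleGraph V) (ident : V → ℕ)
    (ω : A.Coins V) : Set (Sym2 V) :=
  {e | ∃ v u, G.Adj v u ∧ ident u ∈ A.output (A.stateAt G ident ω A.rounds v) ∧ e = s(v, u)}

/-- The probability of the event `P` when all the private random bits of all the vertices are
independent fair coins, that is, under the uniform distribution on the finite set of outcomes. -/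
noncomputable def prob (A : LocalAlgorithm) (V : Type*) (P : A.Coins V → Prop) : ℝ :=
  (Nat.card {ω : A.Coins V // P ω} : ℝ) / (Nat.card (A.Coins V) : ℝ)

end LocalAlgorithm

/-! The algorithm combines a random clustering in the style of Linial and Saks with region growing.
In one clustering every vertex draws a truncated geometric radius, measured in multiples of a scale
`D`. A vertex belongs to the largest identifier whose ball reaches it, but only if it lies at least
`D` inside that ball. Clusters with different centers are then more than `D` apart. Up to the rare
event that some vertex tosses only `true`, a vertex stays unclustered with probability at most 1/2
(`two_mul_card_unclustered_le`), so after logarithmically many clusterings every vertex has been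
clustered at least once with high probability (`card_exists_unclustered_le`).

In each clustering, every center considers the live (not yet removed) edges within `j` growth steps
of its cluster. The least cost of covering them never exceeds the number of available edges, so it
cannot grow by a factor above `1 + ε` in every step: some cover of the edges of step `j + 1` costs
at most `1 + ε` times any cover of the edges of step `j` (`exists_cover_growth`). The center buys
that cover and removes the edges of step `j + 1`.

For the cost, fix a spanner `T`. Its edges within distance `k` of the step-`j` edges already cover
these, so a purchase costs at most `1 + ε` times that part of `T` (`ncard_choiceAt_le`). The parts
are disjoint (`disjoint_part`): the layer between steps `j` and `j + 1` keeps later clusterings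
away, and the separation of clusters handles a single clustering. Summing gives the approximation.
An edge is covered because, once an endpoint is clustered, it is either removed already or removed
now, and removed edges are covered. -/

/-! ### Bounded reachability inside an edge set -/

/-- The pair `a, b` is joined by a walk of length at most `m` all of whose edges lie in `S`. -/
def Reach {α : Type*} (S : Set (Sym2 α)) : ℕ → α → α → Prop
  | 0, a, b => a = b
  | m + 1, a, b => a = b ∨ ∃ c, s(a, c) ∈ S ∧ Reach S m c b

namespace Reach

variable {α β : Type*} {S S' : Set (Sym2 α)} {m : ℕ} {a b : α}

theorem refl (S : Set (Sym2 α)) (m : ℕ) (a : α) : Reach S m a a := by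
  cases m with
  | zero => rfl
  | succ m => exact Or.inl rfl

theorem succ (h : Reach S m a b) : Reach S (m + 1) a b := by
  induction m generalizing a with
  | zero => exact Or.inl h
  | succ m ih =>
    rcases h with h | ⟨c, hc, h⟩
    · exact Or.inl h
    · exact Or.inr ⟨c, hc, ih h⟩

theorem mono (hS : S ⊆ S') (h : Reach S m a b) : Reach S' m a b := by
  induction m generalizing a with
  | zero => exact h
  | succ m ih =>
    rcases h with h | ⟨c, hc, h⟩
    · exact Or.inl h
    · exact Or.inr ⟨c, hS hc, ih h⟩

theorem of_mem (hm : 1 ≤ m) (h : s(a, b) ∈ S) : Reach S m a b := by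
  obtain ⟨m, rfl⟩ := Nat.exists_eq_add_of_le' hm
  exact Or.inr ⟨b, h, refl S m b⟩

theorem map (f : α → β) (h : Reach S m a b) : Reach (Sym2.map f '' S) m (f a) (f b) := by
  induction m generalizing a with
  | zero => exact congrArg f h
  | succ m ih =>
    rcases h with h | ⟨c, hc, h⟩
    · exact Or.inl (congrArg f h)
    · exact Or.inr ⟨f c, ⟨_, hc, rfl⟩, ih h⟩

theorem of_map {f : α → β} (hf : Function.Injective f)
    (h : Reach (Sym2.map f '' S) m (f a) (f b)) : Reach S m a b := by
  induction m generalizing a with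
  | zero => exact hf h
  | succ m ih =>
    rcases h with h | ⟨c, ⟨e, he, hec⟩, h⟩
    · exact Or.inl (hf h)
    · induction e with
      | _ x y =>
        rw [Sym2.map_mk, Sym2.eq_iff] at hec
        rcases hec with ⟨h1, rfl⟩ | ⟨rfl, h2⟩
        · obtain rfl := hf h1
          exact Or.inr ⟨y, he, ih h⟩
        · obtain rfl := hf h2
          exact Or.inr ⟨x, by rwa [Sym2.eq_swap], ih h⟩

theorem trans {n : ℕ} {c : α} (h : Reach S m a b) (h' : Reach S n b c) :
    Reach S (m + n) a c := by
  induction m generalizing a with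
  | zero =>
    obtain rfl : a = b := h
    rwa [Nat.zero_add]
  | succ m ih =>
    rw [Nat.succ_add]
    rcases h with rfl | ⟨d, hd, h⟩
    · exact (ih (refl S m a)).succ
    · exact Or.inr ⟨d, hd, ih h⟩

theorem symm (h : Reach S m a b) : Reach S m b a := by
  induction m generalizing a with
  | zero => exact Eq.symm h
  | succ m ih =>
    rcases h with rfl | ⟨c, hc, h⟩
    · exact refl S _ _
    · exact (ih h).trans (of_mem le_rfl (by rwa [Sym2.eq_swap]))

theorem exists_walk (h : Reach S m a b) :
    ∃ p : (SimpleGraph.fromEdgeSet S).Walk a b, p.length ≤ m := by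
  induction m generalizing a with
  | zero =>
    obtain rfl : a = b := h
    exact ⟨.nil, le_rfl⟩
  | succ m ih =>
    rcases h with rfl | ⟨c, hc, h⟩
    · exact ⟨.nil, Nat.zero_le _⟩
    · obtain ⟨p, hp⟩ := ih h
      by_cases hac : a = c
      · subst hac
        exact ⟨p, hp.trans (Nat.le_succ m)⟩
      · exact ⟨.cons ((SimpleGraph.fromEdgeSet_adj S).2 ⟨hc, hac⟩) p, by simpa using hp⟩

theorem of_walk (p : (SimpleGraph.fromEdgeSet S).Walk a b) (hp : p.length ≤ m) :
    Reach S m a b := by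
  induction p generalizing m with
  | nil => exact refl S m _
  | cons h p ih =>
    rw [SimpleGraph.Walk.length_cons] at hp
    obtain ⟨m, rfl⟩ := Nat.exists_eq_add_of_le' (show 1 ≤ m by omega)
    exact Or.inr ⟨_, ((SimpleGraph.fromEdgeSet_adj S).1 h).1, ih (by omega)⟩

end Reach

/-- Cutting the cycles out of a walk only shortens it, so paths can be traded for walks, which are
easier to transport along the identifier map. -/
theorem edgeCovered_iff_reach {V : Type*} {S : Set (Sym2 V)} {k : ℕ} {u v : V} :
    EdgeCovered S k u v ↔ Reach S k u v := by
  classical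
  constructor
  · rintro ⟨p, -, hp⟩
    exact Reach.of_walk p hp
  · intro h
    obtain ⟨p, hp⟩ := h.exists_walk
    exact ⟨p.bypass, p.bypass_isPath, p.length_bypass_le_length.trans hp⟩

/-- Walks of length at most `k` from `a` stay within distance `k` of `a`. -/
theorem Reach.restrict_ball {V : Type*} {G : SimpleGraph V} (hG : G.Connected)
    {T : Set (Sym2 V)} (hT : T ⊆ G.edgeSet) {k m : ℕ} {a c b : V}
    (hc : G.dist a c + m ≤ k) (h : Reach T m c b) :
    Reach {e | e ∈ T ∧ ∀ x ∈ e, G.dist a x ≤ k} m c b := by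
  induction m generalizing c with
  | zero => exact h
  | succ m ih =>
    rcases h with h | ⟨d, hd, h⟩
    · exact Or.inl h
    · have h1 : G.dist c d = 1 := SimpleGraph.dist_eq_one_iff_adj.2 (hT hd)
      have h2 := hG.dist_triangle (u := a) (v := c) (w := d)
      refine Or.inr ⟨d, ⟨hd, ?_⟩, ih (by omega) h⟩
      intro x hx
      rcases Sym2.mem_iff.1 hx with rfl | rfl <;> omega

/-! ### Phased algorithms that collect views -/

/-- What a vertex can tell about itself: its identifier, those of its neighbours, and a label. -/
structure VertexRecord (Λ : Type) where
  /-- the identifier -/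
  id : ℕ
  /-- the identifiers of the neighbours -/
  nbrs : Set ℕ
  /-- the label -/
  label : Λ

/-- The record of the vertex `v` of `G` under the labelling `L`. -/
def recordOf {V : Type*} {Λ : Type} (G : SimpleGraph V) (ident : V → ℕ) (L : V → Λ) (v : V) :
    VertexRecord Λ :=
  ⟨ident v, ident '' G.neighborSet v, L v⟩

/-- The records of all vertices within distance `s` of `v`, each with upper bounds (at most `s`) for
its distance. -/
def ballView {V : Type*} {Λ : Type} (G : SimpleGraph V) (ident : V → ℕ) (L : V → Λ) (s : ℕ)
    (v : V) : Set (ℕ × VertexRecord Λ) :=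
  {x | ∃ u, x.2 = recordOf G ident L u ∧ G.dist v u ≤ x.1 ∧ x.1 ≤ s}

/-- The labelling after `n` phases, where in every phase each vertex computes its new label from
its view of radius `s`. -/
def labelAt {V : Type*} {Λ : Type} (G : SimpleGraph V) (ident : V → ℕ) (L₀ : V → Λ)
    (Φ : ℕ → VertexRecord Λ → Set (ℕ × VertexRecord Λ) → Λ) (s : ℕ) : ℕ → V → Λ
  | 0 => L₀
  | n + 1 => fun v => Φ n (recordOf G ident (labelAt G ident L₀ Φ s n) v)
      (ballView G ident (labelAt G ident L₀ Φ s n) s v)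

open Classical in
/-- One round of a phased algorithm, from the number of the phase, the number of the round within the
phase, the own record and the view collected in this phase. -/
noncomputable def phasedStep {Λ : Type} (s : ℕ)
    (Φ : ℕ → VertexRecord Λ → Set (ℕ × VertexRecord Λ) → Λ)
    (st : ℕ × ℕ × VertexRecord Λ × Set (ℕ × VertexRecord Λ))
    (M : Set (ℕ × Set (ℕ × VertexRecord Λ))) :
    ℕ × ℕ × VertexRecord Λ × Set (ℕ × VertexRecord Λ) :=
  let K : Set (ℕ × VertexRecord Λ) :=
    {x | (x.2 = st.2.2.1 ∧ x.1 ≤ st.2.1 + 1) ∨ ∃ m ∈ M, ∃ t, x.1 = t + 1 ∧ (t, x.2) ∈ m.2}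
  if st.2.1 + 1 = s then
    let r : VertexRecord Λ := ⟨st.2.2.1.id, st.2.2.1.nbrs, Φ st.1 st.2.2.1 K⟩
    (st.1 + 1, 0, r, {(0, r)})
  else (st.1, st.2.1 + 1, st.2.2.1, K)

/-- The local algorithm that consists of `p` phases of `s` rounds each, in which views of radius `s`
are collected. -/
noncomputable def phasedAlgorithm (Λ : Type) (coins p s : ℕ) (ι : (Fin coins → Bool) → Λ)
    (Φ : ℕ → VertexRecord Λ → Set (ℕ × VertexRecord Λ) → Λ) (out : VertexRecord Λ → Set ℕ) :
    LocalAlgorithm where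
  State := ℕ × ℕ × VertexRecord Λ × Set (ℕ × VertexRecord Λ)
  Msg := Set (ℕ × VertexRecord Λ)
  coins := coins
  rounds := p * s
  init a nb f := (0, 0, ⟨a, nb, ι f⟩, {(0, ⟨a, nb, ι f⟩)})
  send st _ := st.2.2.2
  step := phasedStep s Φ
  output st := out st.2.2.1

section Phased

variable {V : Type*} {Λ : Type} {G : SimpleGraph V} (hG : G.Connected) (ident : V → ℕ)

include hG

theorem ballView_zero (L : V → Λ) (v : V) :
    ballView G ident L 0 v = {(0, recordOf G ident L v)} := by
  ext ⟨t, r⟩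
  simp only [ballView, Set.mem_ofPred_eq, Set.mem_singleton_iff, Prod.mk.injEq]
  constructor
  · rintro ⟨u, rfl, h1, h2⟩
    obtain rfl : t = 0 := by omega
    obtain rfl := (hG.dist_eq_zero_iff).1 (Nat.le_zero.1 h1)
    exact ⟨rfl, rfl⟩
  · rintro ⟨rfl, rfl⟩
    exact ⟨v, rfl, by simp, le_rfl⟩

/-- Because upper bounds are recorded instead of exact distances, a vertex only increments what its
neighbours report and never has to minimize. A shortest walk to another vertex starts with a
neighbour whose distance to it is smaller by one. -/
theorem ballView_succ (L : V → Λ) (s : ℕ) (v : V) :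
    ballView G ident L (s + 1) v =
      {x | (x.2 = recordOf G ident L v ∧ x.1 ≤ s + 1) ∨
        ∃ u, G.Adj v u ∧ ∃ t, x.1 = t + 1 ∧ (t, x.2) ∈ ballView G ident L s u} := by
  ext ⟨t, r⟩
  simp only [ballView, Set.mem_ofPred_eq]
  constructor
  · rintro ⟨w, rfl, h1, h2⟩
    by_cases hvw : v = w
    · subst hvw
      exact Or.inl ⟨rfl, h2⟩
    · right
      obtain ⟨p, hp⟩ := hG.exists_walk_length_eq_dist v w
      cases p with
      | nil => exact absurd rfl hvw
      | @cons _ u _ h p =>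
        rw [SimpleGraph.Walk.length_cons] at hp
        have := SimpleGraph.dist_le p
        exact ⟨u, h, t - 1, by omega, w, rfl, by omega, by omega⟩
  · rintro (⟨rfl, h⟩ | ⟨u, hu, t', rfl, w, rfl, h1, h2⟩)
    · exact ⟨v, rfl, by simp, h⟩
    · have h3 : G.dist v u = 1 := SimpleGraph.dist_eq_one_iff_adj.2 hu
      have h4 := hG.dist_triangle (u := v) (v := u) (w := w)
      exact ⟨w, rfl, by omega, by omega⟩

theorem phasedAlgorithm_stateAt {coins p s : ℕ} (ι : (Fin coins → Bool) → Λ)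
    (Φ : ℕ → VertexRecord Λ → Set (ℕ × VertexRecord Λ) → Λ) (out : VertexRecord Λ → Set ℕ)
    (ω : V → Fin coins → Bool) (n j : ℕ) (hj : j < s) (v : V) :
    (phasedAlgorithm Λ coins p s ι Φ out).stateAt G ident ω (n * s + j) v =
      (n, j, recordOf G ident (labelAt G ident (fun u => ι (ω u)) Φ s n) v,
        ballView G ident (labelAt G ident (fun u => ι (ω u)) Φ s n) j v) := by
  let σ : ℕ → V → ℕ × ℕ × VertexRecord Λ × Set (ℕ × VertexRecord Λ) := fun r v =>
    (phasedAlgorithm Λ coins p s ι Φ out).stateAt G ident ω r v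
  have hstep : ∀ r v, σ (r + 1) v = phasedStep s Φ (σ r v)
      {m | ∃ u, G.Adj v u ∧ m = (ident u, (σ r u).2.2.2)} := fun r v => rfl
  set L := labelAt G ident (fun u => ι (ω u)) Φ s with hL
  have key : ∀ (r n j : ℕ), j < s → r = n * s + j → ∀ v,
      σ r v = (n, j, recordOf G ident (L n) v, ballView G ident (L n) j v) := by
    intro r
    induction r with
    | zero =>
      intro n j hj hr v
      have hn : n = 0 := by
        rcases Nat.eq_zero_or_pos n with h | h
        · exact h
        · have := Nat.mul_pos h (show 0 < s by omega)
          omega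
      subst hn
      obtain rfl : j = 0 := by omega
      rw [ballView_zero hG]
      rfl
    | succ r ih =>
      intro n j hj hr v
      have hK : ∀ n' j', j' < s → r = n' * s + j' →
          {x : ℕ × VertexRecord Λ | (x.2 = recordOf G ident (L n') v ∧ x.1 ≤ j' + 1) ∨
            ∃ m ∈ {m : ℕ × Set (ℕ × VertexRecord Λ) | ∃ u, G.Adj v u ∧
              m = (ident u, (σ r u).2.2.2)}, ∃ t, x.1 = t + 1 ∧ (t, x.2) ∈ m.2} =
          ballView G ident (L n') (j' + 1) v := by
        intro n' j' hj' hr'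
        rw [ballView_succ hG]
        ext x
        simp only [Set.mem_ofPred_eq]
        refine or_congr Iff.rfl ?_
        constructor
        · rintro ⟨_, ⟨u, hu, rfl⟩, t, ht, hx⟩
          rw [ih n' j' hj' hr' u] at hx
          exact ⟨u, hu, t, ht, hx⟩
        · rintro ⟨u, hu, t, ht, hx⟩
          refine ⟨_, ⟨u, hu, rfl⟩, t, ht, ?_⟩
          rw [ih n' j' hj' hr' u]
          exact hx
      rw [hstep]
      rcases j with _ | j
      -- Counter 0 after at least one round means that a phase has just ended: the preceding round
      -- had counter `s - 1`, and `Φ` was applied to the completed view of radius `s`.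
      · obtain ⟨n, rfl⟩ : ∃ n', n = n' + 1 := by
          rcases n with _ | n
          · omega
          · exact ⟨n, rfl⟩
        rw [Nat.succ_mul] at hr
        have hr' : r = n * s + (s - 1) := by omega
        have hs : s - 1 + 1 = s := by omega
        have hK' := hK n (s - 1) (by omega) hr'
        rw [hs] at hK'
        simp only [phasedStep]
        rw [ih n (s - 1) (by omega) hr' v]
        simp only [hs, if_true]
        rw [hK', ballView_zero hG]
        rfl
      · have hr' : r = n * s + j := by omega
        simp only [phasedStep]
        rw [ih n j (by omega) hr' v]
        simp only
        rw [hK n j (by omega) hr', if_neg (by omega)]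
  exact key _ n j hj rfl v

theorem phasedAlgorithm_outputEdges {coins p s : ℕ} (hs : 0 < s) (ι : (Fin coins → Bool) → Λ)
    (Φ : ℕ → VertexRecord Λ → Set (ℕ × VertexRecord Λ) → Λ) (out : VertexRecord Λ → Set ℕ)
    (ω : V → Fin coins → Bool) :
    (phasedAlgorithm Λ coins p s ι Φ out).outputEdges G ident ω =
      {e | ∃ v u, G.Adj v u ∧
        ident u ∈ out (recordOf G ident (labelAt G ident (fun u => ι (ω u)) Φ s p) v) ∧
        e = s(v, u)} := by
  have h := phasedAlgorithm_stateAt hG ident (p := p) ι Φ out ω p 0 hs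
  simp only [LocalAlgorithm.outputEdges]
  ext e
  refine exists_congr fun v => exists_congr fun u => and_congr_right fun _ =>
    and_congr_left fun _ => ?_
  have h' := h v
  rw [Nat.add_zero] at h'
  change ident u ∈ out ((phasedAlgorithm Λ coins p s ι Φ out).stateAt G ident ω (p * s) v).2.2.1
    ↔ _
  rw [h']

end Phased

/-! ### Region growing -/

/-- `S` covers every edge of `F` with stretch `k`. -/
def Covers {α : Type*} (k : ℕ) (S F : Set (Sym2 α)) : Prop :=
  ∀ a b, s(a, b) ∈ F → Reach S k a b

/-- Growing a region until the cost of covering it grows by a factor of at most `1 + ε`. -/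
theorem exists_cover_growth {α : Type*} {k : ℕ} (hk : 1 ≤ k) {ε : ℝ} (hε : 0 < ε)
    {E : Set (Sym2 α)} (F : ℕ → Set (Sym2 α)) (hF : ∀ j, F j ⊆ E) {J : ℕ}
    (hJ : (E.ncard : ℝ) < (1 + ε) ^ J) :
    ∃ j ≤ J, ∃ S ⊆ E, Covers k S (F (j + 1)) ∧
      ∀ S' ⊆ E, Covers k S' (F j) → (S.ncard : ℝ) ≤ (1 + ε) * (S'.ncard : ℝ) := by
  have hne : ∀ j, {n : ℕ | ∃ S ⊆ E, Covers k S (F j) ∧ S.ncard = n}.Nonempty := fun j =>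
    ⟨_, E, subset_rfl, fun a b hab => Reach.of_mem hk (hF j hab), rfl⟩
  set cost : ℕ → ℕ := fun j => sInf {n : ℕ | ∃ S ⊆ E, Covers k S (F j) ∧ S.ncard = n} with hcost
  have hmin : ∀ j, ∀ S ⊆ E, Covers k S (F j) → cost j ≤ S.ncard := fun j S hS hc =>
    Nat.sInf_le ⟨S, hS, hc, rfl⟩
  by_contra hcon
  push Not at hcon
  have hgrow : ∀ j ≤ J, (1 + ε) * (cost j : ℝ) < cost (j + 1) := by
    intro j hj
    obtain ⟨S, hS, hc, hn⟩ := Nat.sInf_mem (hne (j + 1))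
    obtain ⟨S', hS', hc', hlt⟩ := hcon j hj S hS hc
    have h1 : (cost j : ℝ) ≤ S'.ncard := by exact_mod_cast hmin j S' hS' hc'
    calc (1 + ε) * (cost j : ℝ) ≤ (1 + ε) * (S'.ncard : ℝ) := by gcongr
      _ < S.ncard := hlt
      _ = cost (j + 1) := by rw [hn]
  have hpow : ∀ j ≤ J, (1 + ε) ^ j ≤ (cost (j + 1) : ℝ) := by
    intro j
    induction j with
    | zero =>
      intro hj
      have h1 := hgrow 0 hj
      -- Strict growth makes the cost positive even if `cost 0 = 0`, and integrality then gives at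
      -- least 1, the base of the geometric growth.
      have h2 : (0 : ℝ) < cost (0 + 1) := lt_of_le_of_lt (by positivity) h1
      have h3 : 1 ≤ cost (0 + 1) := by exact_mod_cast h2
      simpa using h3
    | succ j ih =>
      intro hj
      have h1 := ih (by omega)
      have h2 := hgrow (j + 1) hj
      calc (1 + ε) ^ (j + 1) = (1 + ε) * (1 + ε) ^ j := by ring
        _ ≤ (1 + ε) * (cost (j + 1) : ℝ) := by gcongr
        _ ≤ _ := h2.le
  have h1 := hpow J le_rfl
  have h2 : (cost (J + 1) : ℝ) ≤ E.ncard := by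
    exact_mod_cast hmin (J + 1) E subset_rfl fun a b hab => Reach.of_mem hk (hF _ hab)
  linarith

/-! ### Random clustering -/

/-- The number of leading `true`s in a sequence of coins. -/
noncomputable def leadingTrues {B : ℕ} (f : Fin B → Bool) : ℕ :=
  open Classical in Nat.findGreatest (fun t => ∀ b : Fin B, b.val < t → f b = true) B

theorem le_leadingTrues_iff {B : ℕ} {f : Fin B → Bool} {t : ℕ} :
    t ≤ leadingTrues f ↔ t ≤ B ∧ ∀ b : Fin B, b.val < t → f b = true := by
  classical
  have hspec := Nat.findGreatest_spec (P := fun t => ∀ b : Fin B, b.val < t → f b = true)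
    (Nat.zero_le B) (fun b hb => absurd hb (Nat.not_lt_zero _))
  constructor
  · intro h
    refine ⟨h.trans (Nat.findGreatest_le B), fun b hb => ?_⟩
    refine hspec b (hb.trans_le ?_)
    unfold leadingTrues at h
    convert h
  · rintro ⟨h1, h2⟩
    unfold leadingTrues
    exact Nat.le_findGreatest (P := fun t => ∀ b : Fin B, b.val < t → f b = true) h1 h2

theorem leadingTrues_le {B : ℕ} (f : Fin B → Bool) : leadingTrues f ≤ B :=
  (le_leadingTrues_iff.1 le_rfl).1

section Clustering

variable {V : Type*} (G : SimpleGraph V) (ident : V → ℕ) (D : ℕ)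

/-- With radii `r`, the vertex `v` is in the cluster of `u`: among the vertices `w` within distance
`r w * D` of `v`, the vertex `u` has the largest identifier, and it has `v` well within its range. -/
def InCluster (r : V → ℕ) (u v : V) : Prop :=
  G.dist v u + D ≤ r u * D ∧ ∀ w, G.dist v w ≤ r w * D → ident w ≤ ident u

variable {G ident D}

/-- The slack `D` in `InCluster` means that each center also reaches the other vertex, so each of
the two identifiers is bounded by the other. -/
theorem InCluster.eq_of_dist_le (hG : G.Connected) (hid : Function.Injective ident)
    {r : V → ℕ} {u u' v v' : V} (h : InCluster G ident D r u v) (h' : InCluster G ident D r u' v')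
    (hd : G.dist v v' ≤ D) : u = u' := by
  have h1 := hG.dist_triangle (u := v) (v := v') (w := u')
  have h2 := hG.dist_triangle (u := v') (v := v) (w := u)
  rw [G.dist_comm (u := v') (v := v)] at h2
  refine hid (le_antisymm (h'.2 u ?_) (h.2 u' ?_))
  · have := h.1
    omega
  · have := h'.1
    omega

/-- Changing one coin puts an unclustered vertex into a cluster. -/
theorem two_mul_card_unclustered_le [Fintype V] [DecidableEq V] (hid : Function.Injective ident)
    (hD : 0 < D) {B : ℕ} (v : V) :
    2 * Nat.card {f : V → Fin B → Bool //
      (¬ ∃ u, InCluster G ident D (fun w => leadingTrues (f w)) u v) ∧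
        ∀ u, ∃ b, f u b = false} ≤ Nat.card (V → Fin B → Bool) := by
  classical
  set Uncl : Finset (V → Fin B → Bool) := Finset.univ.filter fun f =>
      (¬ ∃ u, InCluster G ident D (fun w => leadingTrues (f w)) u v) ∧
        ∀ u, ∃ b, f u b = false with hU
  set Cl : Finset (V → Fin B → Bool) := Finset.univ.filter fun f =>
      ∃ u, InCluster G ident D (fun w => leadingTrues (f w)) u v with hC
  have hdisj : Disjoint Uncl Cl := by
    rw [Finset.disjoint_left]
    intro f hf hf'
    rw [hU, Finset.mem_filter] at hf
    rw [hC, Finset.mem_filter] at hf'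
    exact hf.2.1 hf'.2
  -- the least number of scales that reaches from `u` to `v`
  have hex : ∀ u, ∃ t, G.dist v u ≤ t * D := fun u =>
    ⟨G.dist v u, Nat.le_mul_of_pos_right _ hD⟩
  let τ : V → ℕ := fun u => Nat.find (hex u)
  have hτ : ∀ u t, G.dist v u ≤ t * D ↔ τ u ≤ t := fun u t =>
    ⟨fun h => Nat.find_min' (hex u) h,
      fun h => (Nat.find_spec (hex u)).trans (Nat.mul_le_mul_right D h)⟩
  have hfind : ∀ f ∈ Uncl, ∃ (u : V) (b : Fin B), b.val = τ u ∧ f u b = false ∧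
      InCluster G ident D
        (fun w => leadingTrues (Function.update f u (Function.update (f u) b true) w)) u v := by
    intro f hf
    rw [hU, Finset.mem_filter] at hf
    obtain ⟨-, hun, htr⟩ := hf
    -- The vertex `v` reaches itself, so a largest identifier `u` reaching `v` exists. As `v` is
    -- unclustered, `u` reaches it without slack, which forces exactly `τ u` leading `true`s.
    -- Turning the next coin of `u` to `true` provides the slack.
    obtain ⟨u, hu, hmax⟩ := Finset.exists_max_image
      (Finset.univ.filter fun w => G.dist v w ≤ leadingTrues (f w) * D) ident
      ⟨v, by simp⟩
    rw [Finset.mem_filter] at hu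
    have hmax' : ∀ w, G.dist v w ≤ leadingTrues (f w) * D → ident w ≤ ident u := fun w hw =>
      hmax w (Finset.mem_filter.2 ⟨Finset.mem_univ _, hw⟩)
    have h1 : τ u ≤ leadingTrues (f u) := (hτ u _).1 hu.2
    have h2 : ¬ τ u + 1 ≤ leadingTrues (f u) := by
      intro h
      refine hun ⟨u, ?_, hmax'⟩
      have h3 := (hτ u (τ u)).2 le_rfl
      have h4 := Nat.mul_le_mul_right D h
      rw [Nat.succ_mul] at h4
      simp only
      omega
    have h1' := le_leadingTrues_iff.1 h1
    have h3 : τ u < B := by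
      by_contra h
      obtain ⟨b, hb⟩ := htr u
      have := h1'.2 b (by have := b.isLt; omega)
      simp [hb] at this
    have h4 : f u ⟨τ u, h3⟩ = false := by
      by_contra h
      rw [Bool.not_eq_false] at h
      refine h2 (le_leadingTrues_iff.2 ⟨h3, fun b hb => ?_⟩)
      rcases Nat.lt_succ_iff_lt_or_eq.1 hb with hb | hb
      · exact h1'.2 b hb
      · have : b = ⟨τ u, h3⟩ := Fin.ext hb
        rw [this, h]
    refine ⟨u, ⟨τ u, h3⟩, rfl, h4, ?_, ?_⟩
    · have h5 : τ u + 1 ≤ leadingTrues (Function.update (f u) ⟨τ u, h3⟩ true) := by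
        refine le_leadingTrues_iff.2 ⟨h3, fun b hb => ?_⟩
        by_cases hbe : b = ⟨τ u, h3⟩
        · rw [hbe, Function.update_self]
        · rw [Function.update_of_ne hbe]
          refine h1'.2 b ?_
          have : b.val ≠ τ u := fun h => hbe (Fin.ext h)
          omega
      have h6 := Nat.mul_le_mul_right D h5
      rw [Nat.succ_mul] at h6
      have h7 := (hτ u (τ u)).2 le_rfl
      simp only [Function.update_self]
      omega
    · intro w hw
      by_cases hwu : w = u
      · rw [hwu]
      · simp only [Function.update_of_ne hwu] at hw
        exact hmax' w hw
  have hcard : Uncl.card ≤ Cl.card := by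
    rcases Uncl.eq_empty_or_nonempty with he | ⟨f₀, hf₀⟩
    · simp [he]
    obtain ⟨u₀, b₀, -⟩ := hfind f₀ hf₀
    have : Nonempty V := ⟨u₀⟩
    have : Nonempty (Fin B) := ⟨b₀⟩
    choose! cu cb hcb hcf hcl using hfind
    refine Finset.card_le_card_of_injOn
      (fun f => Function.update f (cu f) (Function.update (f (cu f)) (cb f) true)) ?_ ?_
    · intro f hf
      rw [Finset.mem_coe, hC, Finset.mem_filter]
      exact ⟨Finset.mem_univ _, cu f, hcl f hf⟩
    · intro f hf g hg hfg
      rw [Finset.mem_coe] at hf hg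
      simp only at hfg
      -- The change can be undone: the new outcome determines `u` as the center of `v`, then the
      -- coin as number `τ u`, and its old value was `false`.
      have hrec : ∀ f ∈ Uncl, f = Function.update
          (Function.update f (cu f) (Function.update (f (cu f)) (cb f) true)) (cu f)
            (Function.update ((Function.update f (cu f)
              (Function.update (f (cu f)) (cb f) true)) (cu f)) (cb f) false) := by
        intro f hf
        rw [Function.update_self, Function.update_idem, Function.update_idem, ← hcf f hf,
          Function.update_eq_self, Function.update_eq_self]
      have hf' := hcl f hf
      have hg' := hcl g hg
      have hu : cu f = cu g := by
        rw [hfg] at hf'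
        exact hid (le_antisymm
          (hg'.2 _ (by have := hf'.1; omega)) (hf'.2 _ (by have := hg'.1; omega)))
      have hb : cb f = cb g := by
        apply Fin.ext
        rw [hcb f hf, hcb g hg, hu]
      rw [hrec f hf, hrec g hg, hfg, hu, hb]
  have htot : Uncl.card + Cl.card ≤ Fintype.card (V → Fin B → Bool) := by
    rw [← Finset.card_union_of_disjoint hdisj]
    exact Finset.card_le_univ _
  rw [Nat.card_eq_fintype_card, Nat.card_eq_fintype_card, Fintype.card_subtype]
  change 2 * Uncl.card ≤ _
  omega

end Clustering

/-- In `p` independent phases, all vertices get clustered in some phase with high probability. -/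
theorem card_exists_unclustered_le {V : Type*} [Fintype V] {G : SimpleGraph V} {ident : V → ℕ}
    (hid : Function.Injective ident) {D : ℕ} (hD : 0 < D) (p : ℕ) :
    2 ^ p * Nat.card {g : Fin p → V → Fin p → Bool //
      ∃ v, ∀ i, ¬ ∃ u, InCluster G ident D (fun w => leadingTrues (g i w)) u v} ≤
      Fintype.card V * (p + 1) * Nat.card (Fin p → V → Fin p → Bool) := by
  classical
  set Ω := Fin p → V → Fin p → Bool
  set A : V → Finset Ω := fun v => Finset.univ.filter fun g => ∀ i,
    (¬ ∃ u, InCluster G ident D (fun w => leadingTrues (g i w)) u v) ∧ ∀ u, ∃ b, g i u b = false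
    with hA
  set Tr : Fin p × V → Finset Ω := fun x => Finset.univ.filter fun g =>
    g x.1 x.2 = fun _ => true with hTr
  have hsub : (Finset.univ.filter fun g : Ω =>
      ∃ v, ∀ i, ¬ ∃ u, InCluster G ident D (fun w => leadingTrues (g i w)) u v) ⊆
      (Finset.univ.biUnion A) ∪ (Finset.univ.biUnion Tr) := by
    intro g hg
    obtain ⟨v, hv⟩ := (Finset.mem_filter.1 hg).2
    rw [Finset.mem_union, Finset.mem_biUnion, Finset.mem_biUnion]
    by_cases h : ∃ x : Fin p × V, g x.1 x.2 = fun _ => true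
    · obtain ⟨x, hx⟩ := h
      exact Or.inr ⟨x, Finset.mem_univ _, Finset.mem_filter.2 ⟨Finset.mem_univ _, hx⟩⟩
    · left
      refine ⟨v, Finset.mem_univ _, Finset.mem_filter.2 ⟨Finset.mem_univ _, fun i =>
        ⟨hv i, fun u => ?_⟩⟩⟩
      by_contra hcon
      push Not at hcon
      exact h ⟨(i, u), funext fun b => by simpa using hcon b⟩
  have hcardA : ∀ v, 2 ^ p * (A v).card ≤ Fintype.card Ω := by
    intro v
    have h1 := two_mul_card_unclustered_le (G := G) hid hD (B := p) v
    rw [Nat.card_eq_fintype_card, Nat.card_eq_fintype_card, Fintype.card_subtype] at h1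
    -- The phases use separate coins, so this event is a product and its count is a `p`-th power.
    have h2 : A v = Fintype.piFinset fun _ : Fin p => Finset.univ.filter fun f =>
        (¬ ∃ u, InCluster G ident D (fun w => leadingTrues (f w)) u v) ∧
          ∀ u, ∃ b, f u b = false := by
      ext g
      refine Iff.trans ?_ Fintype.mem_piFinset.symm
      simp only [hA, Finset.mem_filter, Finset.mem_univ, true_and]
    rw [h2, Fintype.card_piFinset, Finset.prod_const, Finset.card_univ, Fintype.card_fin,
      ← mul_pow, Fintype.card_fun (α := Fin p), Fintype.card_fin]
    exact Nat.pow_le_pow_left h1 p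
  have hcardT : ∀ x, 2 ^ p * (Tr x).card ≤ Fintype.card Ω := by
    rintro ⟨i, u⟩
    -- Overwriting the all-`true` block by arbitrary coins is injective, which gives probability at
    -- most `2 ^ (-p)`.
    have h1 : (Tr (i, u) ×ˢ (Finset.univ : Finset (Fin p → Bool))).card ≤
        (Finset.univ : Finset Ω).card := by
      refine Finset.card_le_card_of_injOn
        (fun z => Function.update z.1 i (Function.update (z.1 i) u z.2)) (fun _ _ => by simp) ?_
      rintro ⟨g, c⟩ hz ⟨g', c'⟩ hz' h
      simp only [Finset.coe_product, Set.mem_prod, Finset.mem_coe, hTr, Finset.mem_filter,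
        Finset.mem_univ, true_and, and_true] at hz hz' h
      have hc : c = c' := by
        have := congrFun (congrFun h i) u
        simpa using this
      have hg : g = g' := by
        funext i' u'
        have := congrFun (congrFun h i') u'
        by_cases hi : i' = i
        · subst hi
          by_cases hu : u' = u
          · subst hu
            rw [hz, hz']
          · simpa [hu] using this
        · simpa [hi] using this
      rw [hc, hg]
    rw [Finset.card_product, Finset.card_univ, Finset.card_univ, Fintype.card_fun,
      Fintype.card_bool, Fintype.card_fin] at h1
    rwa [mul_comm]
  rw [Nat.card_eq_fintype_card, Nat.card_eq_fintype_card, Fintype.card_subtype]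
  calc 2 ^ p * _ ≤ 2 ^ p * ((Finset.univ.biUnion A) ∪ (Finset.univ.biUnion Tr)).card :=
        Nat.mul_le_mul_left _ (Finset.card_le_card hsub)
    _ ≤ 2 ^ p * (∑ v, (A v).card + ∑ x, (Tr x).card) :=
        Nat.mul_le_mul_left _ ((Finset.card_union_le _ _).trans
          (add_le_add Finset.card_biUnion_le Finset.card_biUnion_le))
    _ = ∑ v, 2 ^ p * (A v).card + ∑ x, 2 ^ p * (Tr x).card := by
        rw [mul_add, Finset.mul_sum, Finset.mul_sum]
    _ ≤ ∑ _v : V, Fintype.card Ω + ∑ _x : Fin p × V, Fintype.card Ω :=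
        add_le_add (Finset.sum_le_sum fun v _ => hcardA v) (Finset.sum_le_sum fun x _ => hcardT x)
    _ = Fintype.card V * (p + 1) * Fintype.card Ω := by
        simp only [Finset.sum_const, Finset.card_univ, Fintype.card_prod, Fintype.card_fin,
          smul_eq_mul]
        ring

/-! ### The spanner algorithm -/

/-- The parameters of the spanner algorithm. -/
structure SpannerParams where
  /-- the stretch -/
  k : ℕ
  /-- the number of clusterings, and the number of coins per vertex in each of them -/
  p : ℕ
  /-- the maximal number of steps in which the region around a cluster grows -/
  J : ℕ
  /-- the approximation parameter -/
  ε : ℝ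

/-- The label of a vertex in the spanner algorithm. -/
structure SpannerLabel (m : ℕ) where
  /-- the private coins -/
  coins : Fin m → Bool
  /-- the identifiers of the centers of the clusters that contain the vertex -/
  center : Set ℕ
  /-- the pairs of a cluster center and an upper bound for the distance to the cluster -/
  near : Set (ℕ × ℕ)
  /-- the edges chosen by the vertex as a cluster center -/
  cover : Set (Sym2 ℕ)
  /-- the edges removed by the vertex as a cluster center -/
  retire : Set (Sym2 ℕ)
  /-- the edges known to have been chosen -/
  chosen : Set (Sym2 ℕ)
  /-- the edges known to have been removed -/
  removed : Set (Sym2 ℕ)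

/-- The edges that occur in a view. -/
def knownEdges {Λ : Type} (K : Set (ℕ × VertexRecord Λ)) : Set (Sym2 ℕ) :=
  {e | ∃ x ∈ K, ∃ b ∈ x.2.nbrs, e = s(x.2.id, b)}

namespace SpannerParams

variable (P : SpannerParams)

/-- The width of a growth step. -/
def width : ℕ := 2 * P.k + 1

/-- The separation of the clusters. -/
def sep : ℕ := 2 * (P.J + 1) * P.width

/-- The radius of the views. -/
def radius : ℕ := P.p * P.sep + (P.J + 2) * P.width

variable {P} in
theorem width_pos : 0 < P.width := Nat.succ_pos _

variable {P} in
theorem sep_pos : 0 < P.sep := Nat.mul_pos (by omega) width_pos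

variable {P} in
theorem radius_pos : 0 < P.radius :=
  Nat.add_pos_right _ (Nat.mul_pos (by omega) width_pos)

/-- The labels of a vertex. -/
abbrev Label : Type := SpannerLabel (P.p * P.p)

/-- The coins for the `i`-th clustering. -/
def block (i : ℕ) (f : Fin (P.p * P.p) → Bool) : Fin P.p → Bool := fun b =>
  if h : i < P.p then f (finProdFinEquiv (⟨i, h⟩, b)) else false

/-- The label with the given coins and nothing else. -/
def initLabel (f : Fin (P.p * P.p) → Bool) : P.Label := ⟨f, ∅, ∅, ∅, ∅, ∅, ∅⟩

/-- A vertex finds the cluster to which it belongs. -/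
noncomputable def clusterStep (i : ℕ) (r : VertexRecord P.Label)
    (K : Set (ℕ × VertexRecord P.Label)) : P.Label :=
  { r.label with
    center := {a | ∃ x ∈ K, x.2.id = a ∧
      x.1 + P.sep ≤ leadingTrues (P.block i x.2.label.coins) * P.sep ∧
      ∀ y ∈ K, y.1 ≤ leadingTrues (P.block i y.2.label.coins) * P.sep → y.2.id ≤ a} }

/-- A vertex finds its distances to the clusters. -/
def nearStep (r : VertexRecord P.Label) (K : Set (ℕ × VertexRecord P.Label)) : P.Label :=
  { r.label with near := {z | ∃ x ∈ K, x.1 = z.2 ∧ z.1 ∈ x.2.label.center} }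

/-- The edges in a view that have not been removed and are within `j` growth steps of the cluster
of `a`. -/
def liveEdges (K : Set (ℕ × VertexRecord P.Label)) (a j : ℕ) : Set (Sym2 ℕ) :=
  {e | ∃ x ∈ K, ∃ y ∈ K, y.2.id ∈ x.2.nbrs ∧ e = s(x.2.id, y.2.id) ∧ e ∉ x.2.label.removed ∧
    (a, j * P.width) ∈ x.2.label.near ∧ (a, j * P.width) ∈ y.2.label.near}

/-- Given the view of the center `a`, the set `z.1` is a cheap cover of the live edges within
`z.2 + 1` growth steps of the cluster. -/
def IsDecision (K : Set (ℕ × VertexRecord P.Label)) (a : ℕ) (z : Set (Sym2 ℕ) × ℕ) : Prop :=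
  z.2 ≤ P.J ∧ z.1 ⊆ knownEdges K ∧ Covers P.k z.1 (P.liveEdges K a (z.2 + 1)) ∧
    ∀ S' ⊆ knownEdges K, Covers P.k S' (P.liveEdges K a z.2) →
      (z.1.ncard : ℝ) ≤ (1 + P.ε) * (S'.ncard : ℝ)

/-- The choice that the center `a` makes. -/
noncomputable def choice (K : Set (ℕ × VertexRecord P.Label)) (a : ℕ) : Set (Sym2 ℕ) × ℕ :=
  Classical.epsilon (P.IsDecision K a)

/-- The centers of the clusters choose edges. -/
noncomputable def decideStep (r : VertexRecord P.Label) (K : Set (ℕ × VertexRecord P.Label)) :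
    P.Label :=
  { r.label with
    cover := (P.choice K r.id).1
    retire := P.liveEdges K r.id ((P.choice K r.id).2 + 1) }

/-- The vertices learn which edges have been chosen and removed. -/
def updateStep (r : VertexRecord P.Label) (K : Set (ℕ × VertexRecord P.Label)) : P.Label :=
  { r.label with
    chosen := r.label.chosen ∪ {e | ∃ x ∈ K, e ∈ x.2.label.cover}
    removed := r.label.removed ∪ {e | ∃ x ∈ K, e ∈ x.2.label.retire} }

/-- The local computation at the end of the `n`-th phase. -/
noncomputable def step (n : ℕ) (r : VertexRecord P.Label) (K : Set (ℕ × VertexRecord P.Label)) :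
    P.Label :=
  if n % 4 = 0 then P.clusterStep (n / 4) r K
  else if n % 4 = 1 then P.nearStep r K
  else if n % 4 = 2 then P.decideStep r K
  else P.updateStep r K

/-- The local algorithm for approximate minimum spanners. -/
noncomputable def algorithm : LocalAlgorithm :=
  phasedAlgorithm P.Label (P.p * P.p) (4 * P.p) P.radius P.initLabel P.step
    fun r => {b | s(r.id, b) ∈ r.label.chosen}

/-! ### What the labels mean during a run -/

section Run

variable {V : Type*} (G : SimpleGraph V) (ident : V → ℕ) (ω : V → Fin (P.p * P.p) → Bool)

/-- The labels after `n` phases. -/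
noncomputable def labels (n : ℕ) : V → P.Label :=
  labelAt G ident (fun u => P.initLabel (ω u)) P.step P.radius n

/-- The view of `v` after `n` phases. -/
def view (n : ℕ) (v : V) : Set (ℕ × VertexRecord P.Label) :=
  ballView G ident (P.labels G ident ω n) P.radius v

/-- In the `i`-th clustering, `v` is in the cluster of `u`. -/
def Clustered (i : ℕ) (u v : V) : Prop :=
  InCluster G ident P.sep (fun w => leadingTrues (P.block i (ω w))) u v

/-- In the `i`-th clustering, `v` is within distance `t` of the cluster of `u`. -/
def NearCluster (i : ℕ) (u : V) (t : ℕ) (v : V) : Prop :=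
  ∃ w, G.dist v w ≤ t ∧ P.Clustered G ident ω i u w

/-- The edges that `v` knows to have been removed before the `i`-th clustering. -/
def removedAt (i : ℕ) (v : V) : Set (Sym2 ℕ) := (P.labels G ident ω (4 * i) v).removed

/-- The edges that `v` knows to have been chosen before the `i`-th clustering. -/
def chosenAt (i : ℕ) (v : V) : Set (Sym2 ℕ) := (P.labels G ident ω (4 * i) v).chosen

/-- The edge `a, b` is live within distance `j * P.width` of the `i`-th cluster of `u`. -/
def LiveAt (i : ℕ) (u : V) (j : ℕ) (a b : V) : Prop :=
  G.Adj a b ∧ s(ident a, ident b) ∉ P.removedAt G ident ω i a ∧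
    P.NearCluster G ident ω i u (j * P.width) a ∧ P.NearCluster G ident ω i u (j * P.width) b

/-- The choice of `u` in the `i`-th clustering. -/
noncomputable def choiceAt (i : ℕ) (u : V) : Set (Sym2 ℕ) × ℕ :=
  P.choice (P.view G ident ω (4 * i + 2) u) (ident u)

theorem labels_cluster (i : ℕ) (v : V) : P.labels G ident ω (4 * i + 1) v =
    P.clusterStep i (recordOf G ident (P.labels G ident ω (4 * i)) v)
      (P.view G ident ω (4 * i) v) := by
  change P.step (4 * i) _ _ = _
  rw [step, if_pos (by omega), show 4 * i / 4 = i by omega]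
  rfl

theorem labels_near (i : ℕ) (v : V) : P.labels G ident ω (4 * i + 2) v =
    P.nearStep (recordOf G ident (P.labels G ident ω (4 * i + 1)) v)
      (P.view G ident ω (4 * i + 1) v) := by
  change P.step (4 * i + 1) _ _ = _
  rw [step, if_neg (by omega), if_pos (by omega)]
  rfl

theorem labels_decide (i : ℕ) (v : V) : P.labels G ident ω (4 * i + 3) v =
    P.decideStep (recordOf G ident (P.labels G ident ω (4 * i + 2)) v)
      (P.view G ident ω (4 * i + 2) v) := by
  change P.step (4 * i + 2) _ _ = _
  rw [step, if_neg (by omega), if_neg (by omega), if_pos (by omega)]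
  rfl

theorem labels_update (i : ℕ) (v : V) : P.labels G ident ω (4 * (i + 1)) v =
    P.updateStep (recordOf G ident (P.labels G ident ω (4 * i + 3)) v)
      (P.view G ident ω (4 * i + 3) v) := by
  change P.step (4 * i + 3) _ _ = _
  rw [step, if_neg (by omega), if_neg (by omega), if_neg (by omega)]
  rfl

theorem labels_coins (n : ℕ) (v : V) : (P.labels G ident ω n v).coins = ω v := by
  induction n with
  | zero => rfl
  | succ n ih =>
    rw [← ih]
    change (P.step n _ _).coins = _
    unfold step
    split_ifs <;> rfl

variable {P G ident ω}

theorem leadingTrues_mul_sep_le (f : Fin P.p → Bool) :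
    leadingTrues f * P.sep ≤ P.p * P.sep := Nat.mul_le_mul_right _ (leadingTrues_le f)

theorem mul_width_le_radius {j : ℕ} (hj : j ≤ P.J + 1) :
    P.p * P.sep + j * P.width + P.width ≤ P.radius := by
  have : (j + 1) * P.width ≤ (P.J + 2) * P.width := Nat.mul_le_mul_right _ (by omega)
  rw [Nat.succ_mul] at this
  unfold radius
  omega

section Labels

variable (hid : Function.Injective ident)

include hid

/-- Radii are at most `P.p * P.sep`, so every competitor for `v` appears in its view. Upper bounds
on distances suffice, since the exact distance is among them. -/
theorem mem_center_iff {i : ℕ} {u v : V} :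
    ident u ∈ (P.labels G ident ω (4 * i + 1) v).center ↔ P.Clustered G ident ω i u v := by
  have hr : P.p * P.sep ≤ P.radius := Nat.le_add_right _ _
  rw [labels_cluster]
  constructor
  · rintro ⟨⟨t, x⟩, ⟨u', hx, h1, h2⟩, h3, h4, h5⟩
    simp only at hx h1 h2 h3 h4 h5
    subst hx
    obtain rfl := hid h3
    simp only [recordOf, labels_coins] at h4
    refine ⟨by simp only; omega, fun w hw => ?_⟩
    have h6 := leadingTrues_mul_sep_le (P.block i (ω w))
    refine h5 (G.dist v w, recordOf G ident _ w) ⟨w, rfl, le_rfl, by simp only at hw ⊢; omega⟩ ?_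
    simpa only [recordOf, labels_coins] using hw
  · rintro ⟨h1, h2⟩
    simp only at h1 h2
    have h6 := leadingTrues_mul_sep_le (P.block i (ω u))
    refine ⟨(G.dist v u, recordOf G ident _ u), ⟨u, rfl, le_rfl, by simp only; omega⟩, rfl, ?_, ?_⟩
    · simpa only [recordOf, labels_coins] using h1
    · rintro ⟨t, y⟩ ⟨w, hy, h3, h4⟩ h5
      simp only at hy h3 h4 h5
      subst hy
      simp only [recordOf, labels_coins] at h5
      exact h2 w (by omega)

theorem mem_near_iff {i : ℕ} {u v : V} {t : ℕ} (ht : t ≤ P.radius) :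
    (ident u, t) ∈ (P.labels G ident ω (4 * i + 2) v).near ↔ P.NearCluster G ident ω i u t v := by
  rw [labels_near]
  constructor
  · rintro ⟨⟨t', x⟩, ⟨w, hx, h1, h2⟩, h3, h4⟩
    simp only at hx h1 h2 h3 h4
    subst hx h3
    exact ⟨w, h1, (mem_center_iff hid).1 h4⟩
  · rintro ⟨w, h1, h2⟩
    exact ⟨(t, recordOf G ident _ w), ⟨w, rfl, h1, ht⟩, rfl, (mem_center_iff hid).2 h2⟩

omit hid in
theorem labels_removed_eq (i : ℕ) (v : V) :
    (P.labels G ident ω (4 * i + 2) v).removed = P.removedAt G ident ω i v := by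
  rw [labels_near]
  change (P.labels G ident ω (4 * i + 1) v).removed = _
  rw [labels_cluster]
  rfl

omit hid in
theorem NearCluster.dist_le (hG : G.Connected) {i j : ℕ} {u v : V} (hj : j ≤ P.J + 1)
    (h : P.NearCluster G ident ω i u (j * P.width) v) : G.dist u v + P.width ≤ P.radius := by
  obtain ⟨w, h1, h2, -⟩ := h
  have h3 := hG.dist_triangle (u := u) (v := w) (w := v)
  rw [G.dist_comm (u := u) (v := w), G.dist_comm (u := w) (v := v)] at h3
  have h4 := leadingTrues_mul_sep_le (P.block i (ω u))
  have h5 := mul_width_le_radius (P := P) hj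
  simp only at h2
  omega

/-- A cluster lies within `P.p * P.sep` of its center, and `j ≤ P.J + 1` growth steps stay within
`P.radius`, so the center sees all the edges in question. -/
theorem mem_liveEdges_iff (hG : G.Connected) {i j : ℕ} (hj : j ≤ P.J + 1) {u : V} {e : Sym2 ℕ} :
    e ∈ P.liveEdges (P.view G ident ω (4 * i + 2) u) (ident u) j ↔
      ∃ a b, e = s(ident a, ident b) ∧ P.LiveAt G ident ω i u j a b := by
  have hr := mul_width_le_radius (P := P) hj
  constructor
  · rintro ⟨⟨t, x⟩, ⟨a, hx, -, -⟩, ⟨t', y⟩, ⟨b, hy, -, -⟩, h1, h2, h3, h4, h5⟩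
    simp only at hx hy
    subst hx hy
    obtain ⟨b', hab, hb⟩ := h1
    obtain rfl := hid hb
    simp only [recordOf, labels_removed_eq] at h2 h3
    subst h2
    exact ⟨a, b', rfl, hab, h3, (mem_near_iff hid (by omega)).1 h4,
      (mem_near_iff hid (by omega)).1 h5⟩
  · rintro ⟨a, b, rfl, hab, h1, h2, h3⟩
    have h4 := h2.dist_le hG hj
    have h5 := h3.dist_le hG hj
    refine ⟨(G.dist u a, recordOf G ident _ a), ⟨a, rfl, le_rfl, by simp only; omega⟩,
      (G.dist u b, recordOf G ident _ b), ⟨b, rfl, le_rfl, by simp only; omega⟩,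
      ⟨b, hab, rfl⟩, rfl, ?_, (mem_near_iff hid (by omega)).2 h2,
      (mem_near_iff hid (by omega)).2 h3⟩
    simpa only [recordOf, labels_removed_eq] using h1

omit hid in
theorem mem_knownEdges_iff {n : ℕ} {u : V} {e : Sym2 ℕ} :
    e ∈ knownEdges (P.view G ident ω n u) ↔
      ∃ a b, e = s(ident a, ident b) ∧ G.Adj a b ∧ G.dist u a ≤ P.radius := by
  constructor
  · rintro ⟨⟨t, x⟩, ⟨a, hx, h1, h2⟩, _, hb, rfl⟩
    simp only at hx
    subst hx
    obtain ⟨b, hab, rfl⟩ := hb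
    exact ⟨a, b, rfl, hab, by simp only at h1 h2; omega⟩
  · rintro ⟨a, b, rfl, hab, h⟩
    exact ⟨(G.dist u a, recordOf G ident _ a), ⟨a, rfl, le_rfl, h⟩, _, ⟨b, hab, rfl⟩, rfl⟩

omit hid in
-- Region growing is applied inside the view, which contains no more edges than `G`. All vertices
-- decide, not only actual centers: without a cluster the live sets are empty, and comparison with
-- the empty cover forces an empty choice.
theorem choiceAt_spec [Finite V] (hk : 1 ≤ P.k) (hε : 0 < P.ε)
    (hJ : (G.edgeSet.ncard : ℝ) < (1 + P.ε) ^ P.J) (i : ℕ) (u : V) :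
    P.IsDecision (P.view G ident ω (4 * i + 2) u) (ident u) (P.choiceAt G ident ω i u) := by
  refine Classical.epsilon_spec (p := P.IsDecision _ _) ?_
  have hF : ∀ j, P.liveEdges (P.view G ident ω (4 * i + 2) u) (ident u) j ⊆
      knownEdges (P.view G ident ω (4 * i + 2) u) := by
    rintro j _ ⟨x, hx, y, -, h1, rfl, -⟩
    exact ⟨x, hx, _, h1, rfl⟩
  have hsub : knownEdges (P.view G ident ω (4 * i + 2) u) ⊆ Sym2.map ident '' G.edgeSet := by
    intro e he
    obtain ⟨a, b, rfl, hab, -⟩ := mem_knownEdges_iff.1 he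
    exact ⟨s(a, b), hab, rfl⟩
  have hcard : ((knownEdges (P.view G ident ω (4 * i + 2) u)).ncard : ℝ) < (1 + P.ε) ^ P.J := by
    refine lt_of_le_of_lt ?_ hJ
    exact_mod_cast (Set.ncard_le_ncard hsub (Set.toFinite _)).trans
      (Set.ncard_image_le (Set.toFinite _))
  obtain ⟨j, hj, S, hS⟩ := exists_cover_growth hk hε _ hF hcard
  exact ⟨(S, j), hj, hS⟩

theorem mem_removedAt_succ (hG : G.Connected) {i : ℕ} {v : V} {e : Sym2 ℕ}
    (hJ : ∀ u, (P.choiceAt G ident ω i u).2 ≤ P.J) :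
    e ∈ P.removedAt G ident ω (i + 1) v ↔ e ∈ P.removedAt G ident ω i v ∨
      ∃ u, G.dist v u ≤ P.radius ∧ ∃ a b, e = s(ident a, ident b) ∧
        P.LiveAt G ident ω i u ((P.choiceAt G ident ω i u).2 + 1) a b := by
  rw [removedAt, labels_update]
  refine or_congr ?_ ?_
  · change e ∈ (P.labels G ident ω (4 * i + 3) v).removed ↔ _
    rw [labels_decide, ← labels_removed_eq]
    rfl
  · constructor
    · rintro ⟨⟨t, x⟩, ⟨u, hx, h1, h2⟩, he⟩
      simp only at hx h1 h2
      subst hx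
      simp only [recordOf] at he
      rw [labels_decide] at he
      exact ⟨u, h1.trans h2, (mem_liveEdges_iff hid hG (Nat.succ_le_succ (hJ u))).1 he⟩
    · rintro ⟨u, hu, he⟩
      refine ⟨(G.dist v u, recordOf G ident _ u), ⟨u, rfl, le_rfl, hu⟩, ?_⟩
      simp only [recordOf]
      rw [labels_decide]
      exact (mem_liveEdges_iff hid hG (Nat.succ_le_succ (hJ u))).2 he

omit hid in
theorem mem_chosenAt_succ {i : ℕ} {v : V} {e : Sym2 ℕ} :
    e ∈ P.chosenAt G ident ω (i + 1) v ↔ e ∈ P.chosenAt G ident ω i v ∨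
      ∃ u, G.dist v u ≤ P.radius ∧ e ∈ (P.choiceAt G ident ω i u).1 := by
  rw [chosenAt, labels_update]
  refine or_congr ?_ ?_
  · change e ∈ (P.labels G ident ω (4 * i + 3) v).chosen ↔ _
    rw [labels_decide]
    change e ∈ (P.labels G ident ω (4 * i + 2) v).chosen ↔ _
    rw [labels_near]
    change e ∈ (P.labels G ident ω (4 * i + 1) v).chosen ↔ _
    rw [labels_cluster]
    rfl
  · constructor
    · rintro ⟨⟨t, x⟩, ⟨u, hx, h1, h2⟩, he⟩
      simp only at hx h1 h2
      subst hx
      simp only [recordOf] at he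
      rw [labels_decide] at he
      exact ⟨u, h1.trans h2, he⟩
    · rintro ⟨u, hu, he⟩
      refine ⟨(G.dist v u, recordOf G ident _ u), ⟨u, rfl, le_rfl, hu⟩, ?_⟩
      simp only [recordOf]
      rw [labels_decide]
      exact he

omit hid in
theorem mem_chosenAt_iff {n : ℕ} {v : V} {e : Sym2 ℕ} :
    e ∈ P.chosenAt G ident ω n v ↔
      ∃ i < n, ∃ u, G.dist v u ≤ P.radius ∧ e ∈ (P.choiceAt G ident ω i u).1 := by
  induction n with
  | zero =>
    constructor
    · intro h
      exact absurd h (Set.notMem_empty e)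
    · rintro ⟨i, hi, -⟩
      omega
  | succ n ih =>
    rw [mem_chosenAt_succ, ih]
    constructor
    · rintro (⟨i, hi, h⟩ | h)
      · exact ⟨i, by omega, h⟩
      · exact ⟨n, by omega, h⟩
    · rintro ⟨i, hi, h⟩
      rcases Nat.lt_succ_iff_lt_or_eq.1 hi with hi | rfl
      · exact Or.inl ⟨i, hi, h⟩
      · exact Or.inr h

theorem mem_removedAt_iff (hG : G.Connected) {n : ℕ} {v : V} {e : Sym2 ℕ}
    (hJ : ∀ i u, (P.choiceAt G ident ω i u).2 ≤ P.J) :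
    e ∈ P.removedAt G ident ω n v ↔
      ∃ i < n, ∃ u, G.dist v u ≤ P.radius ∧ ∃ a b, e = s(ident a, ident b) ∧
        P.LiveAt G ident ω i u ((P.choiceAt G ident ω i u).2 + 1) a b := by
  induction n with
  | zero =>
    constructor
    · intro h
      exact absurd h (Set.notMem_empty e)
    · rintro ⟨i, hi, -⟩
      omega
  | succ n ih =>
    rw [mem_removedAt_succ hid hG (hJ n), ih]
    constructor
    · rintro (⟨i, hi, h⟩ | h)
      · exact ⟨i, by omega, h⟩
      · exact ⟨n, by omega, h⟩
    · rintro ⟨i, hi, h⟩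
      rcases Nat.lt_succ_iff_lt_or_eq.1 hi with hi | rfl
      · exact Or.inl ⟨i, hi, h⟩
      · exact Or.inr h

end Labels

end Run

end SpannerParams

/-! ### Correctness and approximation ratio -/

namespace SpannerParams

section Analysis

variable {P : SpannerParams} {V : Type*} {G : SimpleGraph V} {ident : V → ℕ}
  {ω : V → Fin (P.p * P.p) → Bool}

/-- The edges of `T` that are close to the core of the region of `u` in the `i`-th clustering. -/
def part (P : SpannerParams) (G : SimpleGraph V) (ident : V → ℕ)
    (ω : V → Fin (P.p * P.p) → Bool) (T : Set (Sym2 V)) (i : ℕ) (u : V) : Set (Sym2 V) :=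
  {e | e ∈ T ∧ ∃ a b, P.LiveAt G ident ω i u (P.choiceAt G ident ω i u).2 a b ∧
    ∀ x ∈ e, G.dist a x ≤ P.k}

/-- Walks in `T` that cover a live edge stay within `k` of its endpoint, so this part of `T`
competes in the decision. It lies in the view of `u` because `P.radius` leaves a spare `P.width ≥
k`. -/
theorem ncard_choiceAt_le [Finite V] (hG : G.Connected) (hid : Function.Injective ident)
    {i : ℕ} {u : V}
    (hdec : P.IsDecision (P.view G ident ω (4 * i + 2) u) (ident u) (P.choiceAt G ident ω i u))
    {T : Set (Sym2 V)} (hT : IsKSpanner G P.k T) :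
    ((P.choiceAt G ident ω i u).1.ncard : ℝ) ≤
      (1 + P.ε) * ((P.part G ident ω T i u).ncard : ℝ) := by
  obtain ⟨hj, -, -, hmin⟩ := hdec
  have hw : P.k ≤ P.width := by unfold width; omega
  rw [← Set.ncard_image_of_injective (P.part G ident ω T i u) (Sym2.map.injective hid)]
  refine hmin _ ?_ ?_
  · rintro _ ⟨e, ⟨heT, a, b, hab, hx⟩, rfl⟩
    induction e with
    | _ x y =>
      refine mem_knownEdges_iff.2 ⟨x, y, rfl, hT.1 heT, ?_⟩
      have h1 := hab.2.2.1.dist_le hG (hj.trans (Nat.le_succ _))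
      have h2 := hG.dist_triangle (u := u) (v := a) (w := x)
      have h3 := hx x (Sym2.mem_mk_left x y)
      omega
  · intro a b hab
    obtain ⟨a', b', he, hlive⟩ := (mem_liveEdges_iff hid hG (hj.trans (Nat.le_succ _))).1 hab
    have key : ∀ c d, Reach {e | e ∈ T ∧ ∀ x ∈ e, G.dist a' x ≤ P.k} P.k c d →
        Reach (Sym2.map ident '' P.part G ident ω T i u) P.k (ident c) (ident d) := by
      intro c d h
      refine Reach.map ident (h.mono ?_)
      rintro e ⟨heT, hx⟩
      exact ⟨heT, a', b', hlive, hx⟩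
    have h1 := Reach.restrict_ball hG hT.1 (k := P.k) (m := P.k) (a := a') (c := a') (by simp)
      (edgeCovered_iff_reach.1 (hT.2 a' b' hlive.1))
    have h2 := key _ _ h1
    rw [Sym2.eq_iff] at he
    rcases he with ⟨rfl, rfl⟩ | ⟨rfl, rfl⟩
    · exact h2
    · exact h2.symm

/-- Removals are never undone, so the edge was already live in clustering `i`. There `u` removed it,
and `a` is close enough to `u` to be told. -/
theorem LiveAt.not_near_of_lt (hG : G.Connected) (hid : Function.Injective ident)
    (hJ : ∀ i u, (P.choiceAt G ident ω i u).2 ≤ P.J) {i i' j' : ℕ} (hi : i < i') {u u' a b : V}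
    (h : P.LiveAt G ident ω i' u' j' a b)
    (ha : P.NearCluster G ident ω i u (((P.choiceAt G ident ω i u).2 + 1) * P.width) a)
    (hb : P.NearCluster G ident ω i u (((P.choiceAt G ident ω i u).2 + 1) * P.width) b) :
    False := by
  refine h.2.1 ((mem_removedAt_iff hid hG hJ).2 ⟨i, hi, u, ?_, a, b, rfl, h.1, ?_, ha, hb⟩)
  · have := ha.dist_le hG (Nat.succ_le_succ (hJ i u))
    rw [G.dist_comm]
    omega
  · intro hr
    obtain ⟨l, hl, hr⟩ := (mem_removedAt_iff hid hG hJ).1 hr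
    exact h.2.1 ((mem_removedAt_iff hid hG hJ).2 ⟨l, hl.trans hi, hr⟩)

theorem NearCluster.of_dist (hG : G.Connected) {i s t : ℕ} {u a b : V}
    (h : P.NearCluster G ident ω i u s a) (hd : s + G.dist b a ≤ t) :
    P.NearCluster G ident ω i u t b := by
  obtain ⟨w, h1, h2⟩ := h
  have := hG.dist_triangle (u := b) (v := a) (w := w)
  exact ⟨w, by omega, h2⟩

/-- A common edge puts `a` and `a'` within `2 * k`. In different clusterings, both ends of the later
live edge are then within `2 * k + 1 = P.width` of `a`, hence in the region already removed. In the
same clustering, the two clusters are within `2 * P.J * P.width + 2 * k ≤ P.sep`, so their centers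
agree. -/
theorem disjoint_part (hG : G.Connected) (hid : Function.Injective ident)
    (hJ : ∀ i u, (P.choiceAt G ident ω i u).2 ≤ P.J) {T : Set (Sym2 V)} {i i' : ℕ} {u u' : V}
    (hne : (i, u) ≠ (i', u')) :
    Disjoint (P.part G ident ω T i u) (P.part G ident ω T i' u') := by
  rw [Set.disjoint_left]
  rintro e ⟨-, a, b, hab, hx⟩ ⟨-, a', b', hab', hx'⟩
  have hd : G.dist a' a ≤ 2 * P.k := by
    induction e with
    | _ x y =>
      have h1 := hx x (Sym2.mem_mk_left x y)
      have h2 := hx' x (Sym2.mem_mk_left x y)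
      have h3 := hG.dist_triangle (u := a') (v := x) (w := a)
      rw [G.dist_comm (u := x) (v := a)] at h3
      omega
  have hearlier : ∀ {i i' : ℕ} {u u' a b a' b' : V}, i < i' → G.dist a' a ≤ 2 * P.k →
      P.LiveAt G ident ω i u (P.choiceAt G ident ω i u).2 a b →
      P.LiveAt G ident ω i' u' (P.choiceAt G ident ω i' u').2 a' b' → False := by
    intro i i' u u' a b a' b' hi hd h h'
    have h1 : G.dist b' a' = 1 := SimpleGraph.dist_eq_one_iff_adj.2 h'.1.symm
    have h2 := hG.dist_triangle (u := b') (v := a') (w := a)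
    refine h'.not_near_of_lt hG hid hJ hi (u := u) (h.2.2.1.of_dist hG ?_) (h.2.2.1.of_dist hG ?_)
    all_goals
      rw [Nat.succ_mul]
      unfold width
      omega
  rcases lt_trichotomy i i' with hi | rfl | hi
  · exact hearlier hi hd hab hab'
  · obtain ⟨w, h1, h2⟩ := hab.2.2.1
    obtain ⟨w', h1', h2'⟩ := hab'.2.2.1
    refine hne ?_
    rw [h2.eq_of_dist_le hG hid h2' ?_]
    have h3 := hG.dist_triangle (u := w) (v := a) (w := w')
    have h4 := hG.dist_triangle (u := a) (v := a') (w := w')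
    rw [G.dist_comm (u := w) (v := a)] at h3
    rw [G.dist_comm (u := a) (v := a')] at h4
    have h5 := Nat.mul_le_mul_right P.width (hJ i u)
    have h6 := Nat.mul_le_mul_right P.width (hJ i u')
    have h7 : P.sep = P.J * P.width + P.J * P.width + 2 * P.width := by unfold sep; ring
    have h8 : 2 * P.k ≤ 2 * P.width := by unfold width; omega
    omega
  · exact hearlier hi (by rwa [G.dist_comm]) hab' hab

theorem algorithm_outputEdges (hG : G.Connected) :
    P.algorithm.outputEdges G ident ω =
      {e | ∃ v u, G.Adj v u ∧ s(ident v, ident u) ∈ P.chosenAt G ident ω P.p v ∧ e = s(v, u)} :=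
  phasedAlgorithm_outputEdges hG ident radius_pos _ _ _ _

theorem isApproxMinSpanner_algorithm [Fintype V] (hG : G.Connected)
    (hid : Function.Injective ident) (hk : 1 ≤ P.k) (hε : 0 < P.ε)
    (hJ : (G.edgeSet.ncard : ℝ) < (1 + P.ε) ^ P.J)
    (hcl : ∀ v, ∃ i < P.p, ∃ u, P.Clustered G ident ω i u v) :
    IsApproxMinSpanner G P.k P.ε (P.algorithm.outputEdges G ident ω) := by
  have hdec := choiceAt_spec (G := G) (ident := ident) (ω := ω) hk hε hJ
  have hJ' : ∀ i u, (P.choiceAt G ident ω i u).2 ≤ P.J := fun i u => (hdec i u).1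
  rw [algorithm_outputEdges hG]
  set H : Set (Sym2 V) :=
    {e | ∃ v u, G.Adj v u ∧ s(ident v, ident u) ∈ P.chosenAt G ident ω P.p v ∧ e = s(v, u)} with hH
  -- A bought edge lies in the view of its buyer, so one of its endpoints hears of the purchase and
  -- outputs it.
  have hsub : ∀ i < P.p, ∀ u, (P.choiceAt G ident ω i u).1 ⊆ Sym2.map ident '' H := by
    intro i hi u e he
    obtain ⟨a, b, rfl, hab, hd⟩ := mem_knownEdges_iff.1 ((hdec i u).2.1 he)
    refine ⟨s(a, b), ⟨a, b, hab, mem_chosenAt_iff.2 ⟨i, hi, u, ?_, he⟩, rfl⟩, rfl⟩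
    rwa [G.dist_comm]
  refine ⟨⟨?_, ?_⟩, ?_⟩
  · rintro _ ⟨v, u, hvu, -, rfl⟩
    exact hvu
  · intro a b hab
    rw [edgeCovered_iff_reach]
    refine Reach.of_map hid ?_
    have hcov : ∀ i < P.p, ∀ u, (∃ a' b', s(ident a, ident b) = s(ident a', ident b') ∧
        P.LiveAt G ident ω i u ((P.choiceAt G ident ω i u).2 + 1) a' b') →
        Reach (Sym2.map ident '' H) P.k (ident a) (ident b) := by
      intro i hi u h
      exact ((hdec i u).2.2.1 _ _ ((mem_liveEdges_iff hid hG (Nat.succ_le_succ (hJ' i u))).2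
        h)).mono (hsub i hi u)
    obtain ⟨i, hi, u, hu⟩ := hcl a
    by_cases hr : s(ident a, ident b) ∈ P.removedAt G ident ω i a
    · obtain ⟨i', hi', u', -, h⟩ := (mem_removedAt_iff hid hG hJ').1 hr
      exact hcov i' (hi'.trans hi) u' h
    -- The edge is still live and `b` is one step from the cluster, so it belongs to growth step `j
    -- + 1` for whatever `j` the center picks.
    · have ha : P.NearCluster G ident ω i u 0 a := ⟨a, by simp, hu⟩
      have h1 : G.dist b a = 1 := SimpleGraph.dist_eq_one_iff_adj.2 hab.symm
      have h2 : 1 ≤ ((P.choiceAt G ident ω i u).2 + 1) * P.width :=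
        Nat.mul_pos (Nat.succ_pos _) width_pos
      exact hcov i hi u ⟨a, b, rfl, hab, hr, ha.of_dist hG (by simp),
        ha.of_dist hG (by omega)⟩
  · intro T hT
    have hcover : Sym2.map ident '' H ⊆
        ⋃ x : Fin P.p × V, (P.choiceAt G ident ω x.1 x.2).1 := by
      rintro _ ⟨_, ⟨v, u, -, h, rfl⟩, rfl⟩
      obtain ⟨i, hi, w, -, h⟩ := mem_chosenAt_iff.1 h
      exact Set.mem_iUnion.2 ⟨(⟨i, hi⟩, w), h⟩
    have hfin : ∀ x : Fin P.p × V, (P.choiceAt G ident ω x.1 x.2).1.Finite := fun x =>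
      (Set.toFinite (Sym2.map ident '' H)).subset (hsub x.1 x.1.isLt x.2)
    have h1 : H.ncard ≤ ∑ x : Fin P.p × V, (P.choiceAt G ident ω x.1 x.2).1.ncard := by
      rw [← Set.ncard_image_of_injective H (Sym2.map.injective hid)]
      exact (Set.ncard_le_ncard hcover (Set.finite_iUnion hfin)).trans
        (Set.ncard_iUnion_le_of_fintype _)
    have h2 : ∑ x : Fin P.p × V, (P.part G ident ω T x.1 x.2).ncard ≤ T.ncard := by
      rw [← finsum_eq_sum_of_fintype, ← Set.ncard_iUnion_of_finite (fun x => Set.toFinite _)]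
      · exact Set.ncard_le_ncard (Set.iUnion_subset fun x e he => he.1) (Set.toFinite _)
      · rintro ⟨i, u⟩ ⟨i', u'⟩ hne
        refine disjoint_part hG hid hJ' fun h => hne ?_
        rw [Prod.mk.injEq] at h ⊢
        exact ⟨Fin.ext h.1, h.2⟩
    calc (H.ncard : ℝ) ≤ ∑ x : Fin P.p × V, ((P.choiceAt G ident ω x.1 x.2).1.ncard : ℝ) := by
          exact_mod_cast h1
      _ ≤ ∑ x : Fin P.p × V, (1 + P.ε) * ((P.part G ident ω T x.1 x.2).ncard : ℝ) :=
          Finset.sum_le_sum fun x _ => ncard_choiceAt_le hG hid (hdec x.1 x.2) hT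
      _ = (1 + P.ε) * ((∑ x : Fin P.p × V, (P.part G ident ω T x.1 x.2).ncard : ℕ) : ℝ) := by
          rw [← Finset.mul_sum, Nat.cast_sum]
      _ ≤ (1 + P.ε) * (T.ncard : ℝ) := by
          gcongr

end Analysis

end SpannerParams

/-! ### Success probability and choice of parameters -/

namespace SpannerParams

/-- The coins of all vertices, grouped by clustering. -/
def coinsEquiv (p : ℕ) (V : Type*) : (V → Fin (p * p) → Bool) ≃ (Fin p → V → Fin p → Bool) where
  toFun ω i u b := ω u (finProdFinEquiv (i, b))
  invFun g u x := g (finProdFinEquiv.symm x).1 u (finProdFinEquiv.symm x).2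
  left_inv ω := by
    funext u x
    exact congrArg (ω u) (finProdFinEquiv.apply_symm_apply x)
  right_inv g := by
    funext i u b
    simp

/-- Each clustering uses fresh coins, so with high probability every vertex gets clustered. -/
theorem card_not_clustered_le (P : SpannerParams) {V : Type*} [Fintype V] {G : SimpleGraph V}
    {ident : V → ℕ} (hid : Function.Injective ident) :
    2 ^ P.p * Nat.card {ω : V → Fin (P.p * P.p) → Bool //
      ¬ ∀ v, ∃ i < P.p, ∃ u, P.Clustered G ident ω i u v} ≤
      Fintype.card V * (P.p + 1) * Nat.card (V → Fin (P.p * P.p) → Bool) := by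
  have h := card_exists_unclustered_le (G := G) hid (sep_pos (P := P)) P.p
  rw [Nat.card_congr (coinsEquiv P.p V)]
  refine le_trans (Nat.mul_le_mul_left _ (le_of_eq ?_)) h
  refine Nat.card_congr ((coinsEquiv P.p V).subtypeEquiv fun ω => ?_)
  push Not
  refine exists_congr fun v => ?_
  have hb : ∀ i : Fin P.p, ∀ w, P.block i (ω w) = coinsEquiv P.p V ω i w := fun i w => by
    funext b
    simp [block, coinsEquiv]
  constructor
  · intro h i u
    have := h i i.isLt u
    simpa only [Clustered, hb] using this
  · intro h i hi u
    have := h ⟨i, hi⟩ u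
    simp only [← hb] at this
    exact this

theorem one_sub_le_prob (P : SpannerParams) {V : Type*} [Fintype V] {G : SimpleGraph V}
    {ident : V → ℕ} (hG : G.Connected) (hid : Function.Injective ident) (hk : 1 ≤ P.k)
    (hε : 0 < P.ε) (hJ : (G.edgeSet.ncard : ℝ) < (1 + P.ε) ^ P.J) :
    1 - (Fintype.card V * (P.p + 1) : ℕ) / (2 : ℝ) ^ P.p ≤
      P.algorithm.prob V fun ω =>
        IsApproxMinSpanner G P.k P.ε (P.algorithm.outputEdges G ident ω) := by
  classical
  have h := P.card_not_clustered_le (G := G) hid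
  set Ω := V → Fin (P.p * P.p) → Bool
  set good : Ω → Prop := fun ω => ∀ v, ∃ i < P.p, ∃ u, P.Clustered G ident ω i u v with hgood
  have hsum : Nat.card {ω // good ω} + Nat.card {ω // ¬ good ω} = Nat.card Ω := by
    rw [← Nat.card_sum]
    exact Nat.card_congr (Equiv.sumCompl good)
  have hle : Nat.card {ω // good ω} ≤ Nat.card {ω : Ω //
      IsApproxMinSpanner G P.k P.ε (P.algorithm.outputEdges G ident ω)} :=
    Nat.card_le_card_of_injective
      (Subtype.map id fun ω hω => isApproxMinSpanner_algorithm hG hid hk hε hJ hω)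
      (Subtype.map_injective _ Function.injective_id)
  have hpos : 0 < Nat.card Ω := Nat.card_pos
  have hpos' : (0 : ℝ) < Nat.card Ω := by exact_mod_cast hpos
  change _ ≤ (Nat.card {ω : Ω //
      IsApproxMinSpanner G P.k P.ε (P.algorithm.outputEdges G ident ω)} : ℝ) / (Nat.card Ω : ℝ)
  rw [le_div_iff₀ hpos']
  have h1 : (2 : ℝ) ^ P.p * (Nat.card {ω // ¬ good ω} : ℝ) ≤
      (Fintype.card V * (P.p + 1) : ℕ) * (Nat.card Ω : ℝ) := by exact_mod_cast h
  have h2 : (Nat.card {ω // ¬ good ω} : ℝ) ≤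
      (Fintype.card V * (P.p + 1) : ℕ) / (2 : ℝ) ^ P.p * (Nat.card Ω : ℝ) := by
    rw [div_mul_eq_mul_div, le_div_iff₀ (by positivity)]
    linarith
  have h3 : (Nat.card {ω // good ω} : ℝ) + (Nat.card {ω // ¬ good ω} : ℝ) = Nat.card Ω := by
    exact_mod_cast hsum
  have h4 : (Nat.card {ω // good ω} : ℝ) ≤ (Nat.card {ω : Ω //
      IsApproxMinSpanner G P.k P.ε (P.algorithm.outputEdges G ident ω)} : ℝ) := by
    exact_mod_cast hle
  rw [sub_mul, one_mul]
  linarith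

/-- The parameters for networks with at most `N` vertices and failure probability `n⁻ᶜ`. -/
noncomputable def ofSize (k c N : ℕ) (ε : ℝ) : SpannerParams where
  k := k
  p := 2 * ((c + 2) * Nat.clog 2 N)
  J := ⌈1 / min ε 1⌉₊ * (2 * Nat.clog 2 N + 1)
  ε := ε

/-- The square is what is needed because `G` has at most `N ^ 2` edges. By Bernoulli, `⌈1 / min ε
1⌉₊` growth factors at least double the cost; the extra doubling makes the inequality strict. -/
theorem sq_lt_one_add_pow {ε : ℝ} (hε : 0 < ε) (N : ℕ) :
    (N : ℝ) ^ 2 < (1 + ε) ^ (⌈1 / min ε 1⌉₊ * (2 * Nat.clog 2 N + 1)) := by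
  have hδ : 0 < min ε 1 := lt_min hε one_pos
  have h1 : (2 : ℝ) ≤ (1 + ε) ^ ⌈1 / min ε 1⌉₊ := by
    have h2 : 1 ≤ (⌈1 / min ε 1⌉₊ : ℝ) * min ε 1 := by
      rw [← div_le_iff₀ hδ]
      exact Nat.le_ceil _
    calc (2 : ℝ) ≤ 1 + (⌈1 / min ε 1⌉₊ : ℝ) * min ε 1 := by linarith
      _ ≤ (1 + min ε 1) ^ ⌈1 / min ε 1⌉₊ := one_add_mul_le_pow (by linarith) _
      _ ≤ _ := by gcongr; exact min_le_left _ _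
  have h3 : (N : ℝ) ≤ 2 ^ Nat.clog 2 N := by
    exact_mod_cast Nat.le_pow_clog one_lt_two N
  rw [pow_mul]
  calc (N : ℝ) ^ 2 ≤ (2 ^ Nat.clog 2 N) ^ 2 := by gcongr
    _ = 2 ^ (2 * Nat.clog 2 N) := by rw [← pow_mul, mul_comm]
    _ < 2 ^ (2 * Nat.clog 2 N + 1) := pow_lt_pow_right₀ one_lt_two (Nat.lt_succ_self _)
    _ ≤ _ := by gcongr

/-- With `p = 2 * m`, one factor `2 ^ m ≥ n ^ (c + 2)` absorbs the powers of `n` and a 2, and the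
other pays for the factor `p + 1 ≤ 2 * 2 ^ m`. -/
theorem failure_le {n N : ℕ} (c : ℕ) (hn : 2 ≤ n) (hN : n ≤ N) :
    ((n * (2 * ((c + 2) * Nat.clog 2 N) + 1) : ℕ) : ℝ) / 2 ^ (2 * ((c + 2) * Nat.clog 2 N)) ≤
      1 / (n : ℝ) ^ c := by
  set m := (c + 2) * Nat.clog 2 N with hm
  have h1 : n ^ c * n * 2 ≤ 2 ^ m := by
    calc n ^ c * n * 2 ≤ n ^ c * n * n := Nat.mul_le_mul_left _ hn
      _ = n ^ (c + 2) := by ring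
      _ ≤ (2 ^ Nat.clog 2 N) ^ (c + 2) :=
        Nat.pow_le_pow_left (hN.trans (Nat.le_pow_clog one_lt_two N)) _
      _ = 2 ^ m := by rw [← pow_mul, mul_comm]
  have h2 : 2 * m + 1 ≤ 2 * 2 ^ m := by
    have : m < 2 ^ m := Nat.lt_two_pow_self
    omega
  have h3 : n * (2 * m + 1) * n ^ c ≤ 2 ^ (2 * m) := by
    calc n * (2 * m + 1) * n ^ c ≤ n * (2 * 2 ^ m) * n ^ c := by gcongr
      _ = (n ^ c * n * 2) * 2 ^ m := by ring
      _ ≤ 2 ^ m * 2 ^ m := Nat.mul_le_mul_right _ h1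
      _ = 2 ^ (2 * m) := by ring
  have hn' : (0 : ℝ) < (n : ℝ) ^ c := by
    have : (0 : ℝ) < n := by exact_mod_cast (by omega : 0 < n)
    positivity
  rw [div_le_div_iff₀ (by positivity) hn', one_mul]
  exact_mod_cast h3

theorem clog_le_three_mul_log {N : ℕ} (hN : 2 ≤ N) : (Nat.clog 2 N : ℝ) ≤ 3 * Real.log N := by
  have h1 : 2 ^ (Nat.clog 2 N).pred < N := Nat.pow_pred_clog_lt_self one_lt_two (by omega)
  have h2 : ((Nat.clog 2 N).pred : ℝ) * Real.log 2 ≤ Real.log N := by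
    rw [← Real.log_pow]
    refine Real.log_le_log (by positivity) ?_
    exact_mod_cast h1.le
  have h3 : (Nat.clog 2 N : ℝ) ≤ ((Nat.clog 2 N).pred : ℝ) + 1 := by
    exact_mod_cast Nat.le_add_of_sub_le (Nat.pred_eq_sub_one (n := Nat.clog 2 N)).ge
  have h4 : Real.log 2 ≤ Real.log N := Real.log_le_log two_pos (by exact_mod_cast hN)
  have h5 := Real.log_two_gt_d9
  have h6 : ((Nat.clog 2 N).pred : ℝ) * 0.69 ≤ ((Nat.clog 2 N).pred : ℝ) * Real.log 2 := by
    gcongr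
    linarith
  linarith

/-- For fixed `k`, `b`, `c` and with `ℓ = Nat.clog 2 N`: `p` is of order `ℓ`, `J` of order `ℓ / min
ε 1`, and the radius of order `p * J`, so the `4 * p` phases take order `ℓ ^ 3 / min ε 1` rounds. -/
theorem rounds_le (k b c : ℕ) {ε : ℝ} (hε : 0 < ε) {n N : ℕ} (hNb : N ≤ n ^ b) :
    ((ofSize k c N ε).algorithm.rounds : ℝ) ≤
      672 * (c + 2) ^ 2 * (2 * k + 1) * (3 * b) ^ 3 * (Real.log n / min ε 1) ^ 3 := by
  have hδ : 0 < min ε 1 := lt_min hε one_pos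
  have hδ1 : min ε 1 ≤ 1 := min_le_right _ _
  have hlog : 0 ≤ Real.log n := Real.log_natCast_nonneg n
  have hr : (ofSize k c N ε).algorithm.rounds =
      4 * (ofSize k c N ε).p * (ofSize k c N ε).radius := rfl
  rw [hr]
  -- For `N < 2` the logarithm vanishes, and so does the number of phases.
  rcases Nat.lt_or_ge N 2 with hN2 | hN2
  · have h0 : (ofSize k c N ε).p = 0 := by
      have : Nat.clog 2 N = 0 := Nat.clog_of_right_le_one (by omega) 2
      simp [ofSize, this]
    rw [h0]
    simp only [mul_zero, zero_mul, Nat.cast_zero]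
    positivity
  set ℓ := Nat.clog 2 N with hℓ
  have hℓ1 : 1 ≤ ℓ := Nat.clog_pos one_lt_two hN2
  have hℓlog : (ℓ : ℝ) ≤ 3 * b * Real.log n := by
    have h1 := clog_le_three_mul_log hN2
    have h2 : Real.log N ≤ b * Real.log n := by
      rw [← Real.log_pow]
      refine Real.log_le_log (by exact_mod_cast (by omega : 0 < N)) ?_
      exact_mod_cast hNb
    linarith
  set J := ⌈1 / min ε 1⌉₊ * (2 * ℓ + 1) with hJ
  have hJ1 : 1 ≤ J := Nat.mul_pos (Nat.ceil_pos.2 (by positivity)) (Nat.succ_pos _)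
  have hJle : (J : ℝ) ≤ 6 * ℓ / min ε 1 := by
    have h1 : (⌈1 / min ε 1⌉₊ : ℝ) ≤ 2 / min ε 1 := by
      have h2 := (Nat.ceil_lt_add_one (a := 1 / min ε 1) (by positivity)).le
      have h3 : 1 ≤ 1 / min ε 1 := by rwa [le_div_iff₀ hδ, one_mul]
      have h4 : 2 / min ε 1 = 1 / min ε 1 + 1 / min ε 1 := by ring
      linarith
    have h2 : ((2 * ℓ + 1 : ℕ) : ℝ) ≤ 3 * ℓ := by exact_mod_cast (by omega : 2 * ℓ + 1 ≤ 3 * ℓ)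
    rw [hJ, Nat.cast_mul]
    calc _ ≤ (2 / min ε 1) * (3 * ℓ : ℝ) := by gcongr
      _ = _ := by ring
  have hnat : 4 * (ofSize k c N ε).p * (ofSize k c N ε).radius ≤
      112 * (c + 2) ^ 2 * (2 * k + 1) * ℓ ^ 2 * J := by
    have hp : (ofSize k c N ε).p = 2 * ((c + 2) * ℓ) := rfl
    have hrad : (ofSize k c N ε).radius = (2 * ((c + 2) * ℓ)) * (2 * (J + 1) * (2 * k + 1)) +
        (J + 2) * (2 * k + 1) := rfl
    rw [hp, hrad]
    have hm : 1 ≤ 2 * ((c + 2) * ℓ) :=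
      Nat.mul_pos two_pos (Nat.mul_pos (Nat.succ_pos _) hℓ1)
    generalize hM : 2 * ((c + 2) * ℓ) = M at hm
    calc 4 * M * (M * (2 * (J + 1) * (2 * k + 1)) + (J + 2) * (2 * k + 1))
        ≤ 4 * M * (M * (2 * (J + J) * (2 * k + 1)) + (J + 2 * J) * (2 * k + 1) * M) := by
          refine Nat.mul_le_mul_left _ (add_le_add ?_ ?_)
          · gcongr
          · refine (Nat.mul_le_mul_right _ ?_).trans (Nat.le_mul_of_pos_right _ hm)
            omega
      _ = 28 * M ^ 2 * (2 * k + 1) * J := by ring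
      _ = 112 * (c + 2) ^ 2 * (2 * k + 1) * ℓ ^ 2 * J := by rw [← hM]; ring
  calc ((4 * (ofSize k c N ε).p * (ofSize k c N ε).radius : ℕ) : ℝ)
      ≤ ((112 * (c + 2) ^ 2 * (2 * k + 1) * ℓ ^ 2 * J : ℕ) : ℝ) := by exact_mod_cast hnat
    _ = 112 * (c + 2) ^ 2 * (2 * k + 1) * (ℓ : ℝ) ^ 2 * J := by push_cast; ring
    _ ≤ 112 * (c + 2) ^ 2 * (2 * k + 1) * (ℓ : ℝ) ^ 2 * (6 * ℓ / min ε 1) := by gcongr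
    _ = 672 * (c + 2) ^ 2 * (2 * k + 1) * (ℓ : ℝ) ^ 3 * (1 / min ε 1) := by ring
    -- A single factor `1 / min ε 1 ≥ 1` would do; it is cubed to share the exponent of the
    -- logarithm.
    _ ≤ 672 * (c + 2) ^ 2 * (2 * k + 1) * (3 * b * Real.log n) ^ 3 * (1 / min ε 1) ^ 3 := by
      gcongr
      exact le_self_pow₀ (by rwa [le_div_iff₀ hδ, one_mul]) (by norm_num)
    _ = _ := by ring

theorem ncard_edgeSet_le {V : Type*} [Fintype V] (G : SimpleGraph V) :
    G.edgeSet.ncard ≤ Fintype.card V ^ 2 := by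
  have hsub : G.edgeSet ⊆ (fun x : V × V => s(x.1, x.2)) '' Set.univ := by
    intro e _
    induction e with
    | _ a b => exact ⟨(a, b), Set.mem_univ _, rfl⟩
  calc G.edgeSet.ncard ≤ _ := Set.ncard_le_ncard hsub (Set.toFinite _)
    _ ≤ (Set.univ : Set (V × V)).ncard := Set.ncard_image_le (Set.toFinite _)
    _ = Fintype.card V ^ 2 := by
      rw [Set.ncard_univ, Nat.card_eq_fintype_card, Fintype.card_prod, sq]

end SpannerParams

theorem mainTheorem6 (k : ℕ) (hk : 1 ≤ k) :
    ∃ d : ℕ, ∀ b c : ℕ, ∃ (C : ℝ) (A : ℕ → ℝ → LocalAlgorithm),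
      ∀ (ε : ℝ), 0 < ε →
      ∀ (V : Type*) [Fintype V] (G : SimpleGraph V), G.Connected →
      ∀ (ident : V → ℕ), Function.Injective ident →
      ∀ (N : ℕ), Fintype.card V ≤ N → N ≤ Fintype.card V ^ b →
        ((A N ε).rounds : ℝ) ≤ C * (Real.log (Fintype.card V) / min ε 1) ^ d ∧
        1 - 1 / (Fintype.card V : ℝ) ^ c ≤
          (A N ε).prob V (fun ω =>
            IsApproxMinSpanner G k ε ((A N ε).outputEdges G ident ω)) := by
  refine ⟨3, fun b c => ⟨672 * (c + 2) ^ 2 * (2 * k + 1) * (3 * b) ^ 3,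
    fun N ε => (SpannerParams.ofSize k c N ε).algorithm, ?_⟩⟩
  intro ε hε V _ G hG ident hid N hN hNb
  have : Nonempty V := hG.nonempty
  refine ⟨SpannerParams.rounds_le k b c hε hNb, ?_⟩
  -- On one vertex the claimed probability bound is 0.
  rcases Nat.lt_or_ge (Fintype.card V) 2 with h2 | h2
  · have h1 : Fintype.card V = 1 := by
      have := Fintype.card_pos (α := V)
      omega
    rw [h1, Nat.cast_one, one_pow, div_one, sub_self]
    exact div_nonneg (Nat.cast_nonneg _) (Nat.cast_nonneg _)
  · have hJ : (G.edgeSet.ncard : ℝ) < (1 + ε) ^ (SpannerParams.ofSize k c N ε).J := by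
      refine lt_of_le_of_lt ?_ (SpannerParams.sq_lt_one_add_pow hε N)
      exact_mod_cast (SpannerParams.ncard_edgeSet_le G).trans (Nat.pow_le_pow_left hN 2)
    refine le_trans ?_
      ((SpannerParams.ofSize k c N ε).one_sub_le_prob hG hid hk hε hJ)
    exact sub_le_sub_left (SpannerParams.failure_le c h2 hN) 1
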